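/- Let $X \neq \{0\}$ be a real Banach space with closed unit ball $B_X$, unit sphere $S_X$ and dual $X^*$. For $x^* \in S_{X^*}$ and $\varepsilon > 0$ put $S(x^*,\varepsilon) = \{z \in B_X : x^*(z) > 1-\varepsilon\}$. Suppose that $X$ is lush, that is, for all $x, y \in S_X$ and every $\varepsilon > 0$ there is $x^* \in S_{X^*}$ such that $x \in S(x^*,\varepsilon)$ and $\operatorname{dist}\bigl(y, \operatorname{aco} S(x^*,\varepsilon)\bigr) < \varepsilon$, where $\operatorname{aco}$ denotes the absolutely convex hull. If $X$ is not one-dimensional, then $X$ is not strictly convex (the set of extreme points of $B_X$ is not equal to $S_X$) and $X$ is not smooth (it is not the case that for every $x \in S_X$ there is a unique $x^* \in S_{X^*}$ with $x^*(x) = 1$). -/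

import Mathlib

/-- The slice `S(f, ε) = {z ∈ B_X : f z > 1 - ε}` of the closed unit ball of a real normed space. -/
def unitBallSlice {X : Type*} [NormedAddCommGroup X] [NormedSpace ℝ X]
    (f : StrongDual ℝ X) (ε : ℝ) : Set X :=
  {z | z ∈ Metric.closedBall (0 : X) 1 ∧ 1 - ε < f z}

/-- A real normed space is lush if for all norm-one `x`, `y` and every `ε > 0` there is a norm-one
functional `f` such that `x` lies in the slice `S(f, ε)` and `y` is at distance less than `ε` from
the absolutely convex hull of that slice (the distance is to a nonempty set, as it contains `x`). -/
def IsLush (X : Type*) [NormedAddCommGroup X] [NormedSpace ℝ X] : Prop :=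
  ∀ x y : X, ‖x‖ = 1 → ‖y‖ = 1 → ∀ ε : ℝ, 0 < ε →
    ∃ f : StrongDual ℝ X, ‖f‖ = 1 ∧ x ∈ unitBallSlice f ε ∧
      Metric.infDist y (absConvexHull ℝ (unitBallSlice f ε)) < ε

/-- A real normed space is strictly convex if the extreme points of its closed unit ball are
exactly its norm-one points (for a nonzero space this is `StrictConvexSpace ℝ X`). -/
def IsStrictlyConvexNorm (X : Type*) [NormedAddCommGroup X] [NormedSpace ℝ X] : Prop :=
  Set.extremePoints ℝ (Metric.closedBall (0 : X) 1) = Metric.sphere (0 : X) 1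

/-- A real normed space is smooth if every norm-one `x` has exactly one norm-one functional `f`
with `f x = 1`. -/
def IsSmoothNorm (X : Type*) [NormedAddCommGroup X] [NormedSpace ℝ X] : Prop :=
  ∀ x : X, ‖x‖ = 1 → ∃! f : StrongDual ℝ X, ‖f‖ = 1 ∧ f x = 1

open Filter Topology

/-! Lushness treats one vector `y` at a time; `IsLush.exists_forall_isNearSliceHull` gives a single
`f` almost norming `x` and approximating every vector of a finite list by `l • a - (1 - l) • b`,
with `a`, `b` in its slice. In dimension at least two this applies to a unit `w` with `|f w| ≤ 1 /
2`, which keeps `l` away from 0 and 1.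

Strict convexity: `‖a + b‖` is almost 2, but `a` and `b` are apart, since otherwise `w` would be too
short. Vectors almost normed by `f` have `l` close to 1, so they are close to the slice itself;
hence `IsLush.exists_pair_near` improves such a pair at small cost, and the limit pair spans a
segment in the sphere.

Smoothness: a functional `h` norming `w` almost norms `a` as well, as does `f`, yet `f w ≤ 1 / 2`
and `h w = 1`. Iterating `IsLush.exists_almostNormingPair_near` gives a limit point where this
separation persists, and weak-star compactness turns it into two distinct support functionals. -/

section Lush

variable {X : Type*} [NormedAddCommGroup X] [NormedSpace ℝ X]

/-- The vector `y` is within `ε` of a combination `l • a - (1 - l) • b` with `a`, `b` in the slice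
`S(f, ε)` and `l ∈ [0, 1]`. -/
def IsNearSliceHull (f : StrongDual ℝ X) (ε : ℝ) (y : X) : Prop :=
  ∃ a b : X, ∃ l : ℝ, a ∈ unitBallSlice f ε ∧ b ∈ unitBallSlice f ε ∧ 0 ≤ l ∧ l ≤ 1 ∧
    ‖y - (l • a - (1 - l) • b)‖ < ε

/-! ### Slices and elementary estimates -/

theorem exists_norm_one_apply_eq [Nontrivial X] (x : X) :
    ∃ g : StrongDual ℝ X, ‖g‖ = 1 ∧ g x = ‖x‖ := by
  simpa using exists_dual_vector' ℝ x

theorem mem_unitBallSlice {f : StrongDual ℝ X} {ε : ℝ} {z : X} :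
    z ∈ unitBallSlice f ε ↔ ‖z‖ ≤ 1 ∧ 1 - ε < f z := by
  simp [unitBallSlice]

theorem convex_unitBallSlice (f : StrongDual ℝ X) (ε : ℝ) : Convex ℝ (unitBallSlice f ε) :=
  (convex_closedBall (0 : X) 1).inter (convex_halfSpace_gt f.toLinearMap.isLinear (1 - ε))

/-- The absolutely convex hull is the convex hull of `S ∪ -S`, and two convex sets need only one
point each in a convex combination. -/
theorem exists_eq_of_mem_absConvexHull {S : Set X} (hS : Convex ℝ S) (hne : S.Nonempty) {z : X}
    (hz : z ∈ absConvexHull ℝ S) :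
    ∃ a ∈ S, ∃ b ∈ S, ∃ l : ℝ, 0 ≤ l ∧ l ≤ 1 ∧ z = l • a - (1 - l) • b := by
  rw [← convexHull_union_neg_eq_absConvexHull, hS.convexHull_union hS.neg hne hne.neg,
    mem_convexJoin] at hz
  obtain ⟨a, ha, b, hb, s, t, hs, ht, hst, rfl⟩ := hz
  refine ⟨a, ha, -b, hb, s, hs, by linarith, ?_⟩
  rw [← hst]
  simp

theorem apply_le_of_norm_le {f : StrongDual ℝ X} (hf : ‖f‖ ≤ 1) {x : X} {r : ℝ} (hx : ‖x‖ ≤ r) :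
    f x ≤ r := by
  have h1 := f.le_opNorm x
  have h2 : ‖f‖ * ‖x‖ ≤ 1 * ‖x‖ := by gcongr
  have h3 := (le_abs_self (f x)).trans_eq (Real.norm_eq_abs _).symm
  linarith

theorem neg_le_apply_of_norm_le {f : StrongDual ℝ X} (hf : ‖f‖ ≤ 1) {x : X} {r : ℝ}
    (hx : ‖x‖ ≤ r) : -r ≤ f x := by
  have := apply_le_of_norm_le hf (x := -x) (by simpa using hx)
  rw [map_neg] at this
  linarith

theorem norm_inv_norm_smul {x : X} (hx : 0 < ‖x‖) : ‖‖x‖⁻¹ • x‖ = 1 := by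
  rw [norm_smul, norm_inv, norm_norm, inv_mul_cancel₀ hx.ne']

theorem lt_apply_of_lt_apply_normalize {f : StrongDual ℝ X} {x : X} (hx : 0 < ‖x‖) {c : ℝ}
    (h : c < f (‖x‖⁻¹ • x)) : c * ‖x‖ < f x := by
  rw [map_smul, smul_eq_mul, inv_mul_eq_div, lt_div_iff₀ hx] at h
  exact h

theorem unitBallSlice_mono (f : StrongDual ℝ X) {ε δ : ℝ} (h : ε ≤ δ) :
    unitBallSlice f ε ⊆ unitBallSlice f δ := fun _ hz => ⟨hz.1, by linarith [hz.2]⟩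

/-- One functional serves finitely many vectors of the unit ball simultaneously. -/
theorem IsLush.exists_forall_isNearSliceHull (hX : IsLush X) (L : List X) :
    (∀ y ∈ L, ‖y‖ ≤ 1) → ∀ x : X, ‖x‖ = 1 → ∀ ε : ℝ, 0 < ε →
    ∃ f : StrongDual ℝ X, ‖f‖ = 1 ∧ 1 - ε < f x ∧ ∀ y ∈ L, IsNearSliceHull f ε y := by
  induction L with
  | nil =>
    intro _ x hx ε hε
    obtain ⟨f, hf, hfx, -⟩ := hX x x hx hx ε hε
    exact ⟨f, hf, hfx.2, by simp⟩
  | cons y L ih =>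
    intro hL x hx ε hε
    wlog hε1 : ε ≤ 1 generalizing ε
    · obtain ⟨f, hf, hfx, h⟩ := this 1 one_pos le_rfl
      have h1 : 1 ≤ ε := by linarith
      refine ⟨f, hf, by linarith, fun y hy => ?_⟩
      obtain ⟨a, b, l, ha, hb, h0, h1', hl⟩ := h y hy
      exact ⟨a, b, l, unitBallSlice_mono f h1 ha, unitBallSlice_mono f h1 hb, h0, h1',
        hl.trans_le h1⟩
    have hη : 0 < ε / 6 := by positivity
    obtain ⟨u, hu, hyu⟩ : ∃ u : X, ‖u‖ = 1 ∧ y = ‖y‖ • u := by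
      by_cases hy : ‖y‖ = 0
      · exact ⟨x, hx, by simp [norm_eq_zero.1 hy]⟩
      · have hy' : 0 < ‖y‖ := lt_of_le_of_ne (norm_nonneg y) (Ne.symm hy)
        exact ⟨‖y‖⁻¹ • y, norm_inv_norm_smul hy', by rw [smul_inv_smul₀ hy]⟩
    obtain ⟨f₁, hf₁, hx₁, hd⟩ := hX x u hx hu (ε / 6) hη
    have hne : (unitBallSlice f₁ (ε / 6)).Nonempty := ⟨x, hx₁⟩
    obtain ⟨z, hz, hzu⟩ := (Metric.infDist_lt_iff (absConvexHull_nonempty.2 hne)).1 hd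
    have hy1 : ‖y‖ ≤ 1 := hL y (by simp)
    have hz' : ‖y‖ • z ∈ absConvexHull ℝ (unitBallSlice f₁ (ε / 6)) :=
      balanced_absConvexHull.smul_mem (by simpa using hy1) hz
    have hyz : ‖y - ‖y‖ • z‖ < ε := by
      have : y - ‖y‖ • z = ‖y‖ • (u - z) := by rw [smul_sub, ← hyu]
      rw [this, norm_smul, norm_norm, ← dist_eq_norm]
      have := mul_le_mul_of_nonneg_right hy1 (dist_nonneg (x := u) (y := z))
      linarith
    obtain ⟨a, ha, b, hb, l, hl0, hl1, hzl⟩ :=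
      exists_eq_of_mem_absConvexHull (convex_unitBallSlice _ _) hne hz'
    rw [mem_unitBallSlice] at ha hb hx₁
    -- A functional almost norming `x + a + b` almost norms each summand, so the induction
    -- hypothesis at the normalised sum keeps `a` and `b` in the new slice. The three slice defects
    -- and the rescaling cost at most `ε / 2` each.
    have hs : f₁ (x + a + b) ≤ ‖x + a + b‖ := apply_le_of_norm_le hf₁.le le_rfl
    rw [map_add, map_add] at hs
    have hs0 : 0 < ‖x + a + b‖ := by linarith
    obtain ⟨f, hf, hfx, hfL⟩ := ih (fun y hy => hL y (by simp [hy])) _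
      (norm_inv_norm_smul hs0) (ε / 6) hη
    have hfs := lt_apply_of_lt_apply_normalize hs0 hfx
    rw [map_add, map_add] at hfs
    have e1 : 3 - ε < (1 - ε / 6) * ‖x + a + b‖ := by nlinarith
    have b1 := apply_le_of_norm_le hf.le hx.le
    have b2 := apply_le_of_norm_le hf.le ha.1
    have b3 := apply_le_of_norm_le hf.le hb.1
    refine ⟨f, hf, by linarith, fun w hw => ?_⟩
    rcases List.mem_cons.1 hw with rfl | hw
    · exact ⟨a, b, l, mem_unitBallSlice.2 ⟨ha.1, by linarith⟩,
        mem_unitBallSlice.2 ⟨hb.1, by linarith⟩, hl0, hl1, hzl ▸ hyz⟩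
    · obtain ⟨a, b, l, ha, hb, h0, h1, hl⟩ := hfL w hw
      have h6 : ε / 6 ≤ ε := by linarith
      exact ⟨a, b, l, unitBallSlice_mono f h6 ha, unitBallSlice_mono f h6 hb, h0, h1,
        hl.trans_le h6⟩

theorem abs_apply_sub_lt {h : StrongDual ℝ X} (hh : ‖h‖ ≤ 1) {y z : X} {ε : ℝ}
    (hyz : ‖y - z‖ < ε) : |h y - h z| < ε := by
  rw [← map_sub, abs_lt]
  obtain ⟨r, hr, hr'⟩ := exists_between hyz
  exact ⟨by linarith [neg_le_apply_of_norm_le hh hr.le], by linarith [apply_le_of_norm_le hh hr.le]⟩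

theorem norm_sub_le_of_norm_sub_comb_lt {y a b : X} {l ε : ℝ} (ha : ‖a‖ ≤ 1) (hb : ‖b‖ ≤ 1)
    (hl : l ≤ 1) (h : ‖y - (l • a - (1 - l) • b)‖ < ε) : ‖y - a‖ ≤ ε + 2 * (1 - l) := by
  have e : y - a = (y - (l • a - (1 - l) • b)) - (1 - l) • (a + b) := by module
  rw [e]
  refine (norm_sub_le _ _).trans ?_
  rw [norm_smul, Real.norm_of_nonneg (by linarith)]
  have h2 : ‖a + b‖ ≤ 2 := (norm_add_le _ _).trans (by linarith)
  have := mul_le_mul_of_nonneg_left h2 (by linarith : 0 ≤ 1 - l)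
  linarith

/-- If `f y` is close to `1`, then the coefficient `l` in an approximate representation of `y` is
close to `1`. -/
theorem one_sub_coeff_le {f : StrongDual ℝ X} (hf : ‖f‖ ≤ 1) {y a b : X} {l ε : ℝ}
    (ha : ‖a‖ ≤ 1) (hb : 1 - ε < f b) (hl0 : 0 ≤ l) (hl : l ≤ 1) (hε : 0 < ε)
    (h : ‖y - (l • a - (1 - l) • b)‖ < ε) : 2 * (1 - l) ≤ 1 - f y + 2 * ε := by
  have h1 := (abs_lt.1 (abs_apply_sub_lt hf h)).2
  simp only [map_sub, map_smul, smul_eq_mul] at h1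
  have h2 := mul_le_mul_of_nonneg_left (apply_le_of_norm_le hf ha) hl0
  have h3 := mul_le_mul_of_nonneg_left hb.le (by linarith : 0 ≤ 1 - l)
  nlinarith [mul_nonneg hl0 hε.le]

/-! ### Segments in the unit sphere -/

/-- A pair in the unit ball whose sum has norm close to `2` can be perturbed a little so that the
norm of the sum gets as close to `2` as desired. -/
theorem IsLush.exists_pair_near (hX : IsLush X) {a b : X} (ha : ‖a‖ ≤ 1) (hb : ‖b‖ ≤ 1)
    {ε δ : ℝ} (hε : 0 < ε) (hε1 : ε ≤ 1) (hab : 2 - ε < ‖a + b‖) (hδ : 0 < δ) :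
    ∃ a' b' : X, ‖a'‖ ≤ 1 ∧ ‖b'‖ ≤ 1 ∧ 2 - δ < ‖a' + b'‖ ∧
      ‖a - a'‖ ≤ 6 * ε ∧ ‖b - b'‖ ≤ 6 * ε := by
  obtain ⟨η, hη, hηε, hηδ⟩ : ∃ η : ℝ, 0 < η ∧ η ≤ ε / 2 ∧ η ≤ δ / 2 :=
    ⟨min (ε / 2) (δ / 2), by positivity, min_le_left _ _, min_le_right _ _⟩
  have hs0 : 0 < ‖a + b‖ := by linarith
  obtain ⟨f, hf, hfx, hfL⟩ := hX.exists_forall_isNearSliceHull [a, b]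
    (by simp [ha, hb]) _ (norm_inv_norm_smul hs0) η hη
  have hfs := lt_apply_of_lt_apply_normalize hs0 hfx
  rw [map_add] at hfs
  have hab2 : ‖a + b‖ ≤ 2 := (norm_add_le _ _).trans (by linarith)
  have e1 : 2 - 2 * ε < (1 - η) * ‖a + b‖ := by nlinarith
  have b1 := apply_le_of_norm_le hf.le ha
  have b2 := apply_le_of_norm_le hf.le hb
  obtain ⟨u, v, l, hu, hv, hl0, hl1, hl⟩ := hfL a (by simp)
  obtain ⟨u', v', l', hu', hv', hl0', hl1', hl'⟩ := hfL b (by simp)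
  rw [mem_unitBallSlice] at hu hv hu' hv'
  have c1 := one_sub_coeff_le hf.le hu.1 hv.2 hl0 hl1 hη hl
  have c2 := one_sub_coeff_le hf.le hu'.1 hv'.2 hl0' hl1' hη hl'
  have d1 := norm_sub_le_of_norm_sub_comb_lt hu.1 hv.1 hl1 hl
  have d2 := norm_sub_le_of_norm_sub_comb_lt hu'.1 hv'.1 hl1' hl'
  have hs := apply_le_of_norm_le hf.le (le_refl ‖u + u'‖)
  rw [map_add] at hs
  exact ⟨u, u', hu.1, hu'.1, by linarith [hu.2, hu'.2], by linarith, by linarith⟩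

/-- Successive approximation in a complete metric space. -/
theorem exists_seq_tendsto_of_geometric_steps {E : Type*} [PseudoMetricSpace E] [CompleteSpace E]
    (P : ℕ → E → Prop) (C : ℝ) (x : E) (hx : P 0 x)
    (step : ∀ n x, P n x → ∃ x', P (n + 1) x' ∧ dist x x' ≤ C * (1 / 2) ^ n) :
    ∃ (u : ℕ → E) (y : E), (∀ n, P n (u n)) ∧ Tendsto u atTop (𝓝 y) ∧ dist x y ≤ 2 * C := by
  choose! F hF hd using step
  let u : ℕ → E := fun n => Nat.rec x F n
  have hu : ∀ n, P n (u n) := fun n => by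
    induction n with
    | zero => exact hx
    | succ n ih => exact hF n _ ih
  have hdu : ∀ n, dist (u n) (u (n + 1)) ≤ C * (1 / 2) ^ n := fun n => hd n _ (hu n)
  have hr : (1 / 2 : ℝ) < 1 := by norm_num
  obtain ⟨y, hy⟩ := cauchySeq_tendsto_of_complete (cauchySeq_of_le_geometric _ C hr hdu)
  refine ⟨u, y, hu, hy, (dist_le_of_le_geometric_of_tendsto₀ _ C hr hdu hy).trans_eq ?_⟩
  ring

/-- In dimension at least two there are unit vectors `x`, `y` with `‖x ± y‖ ≥ 1`. -/
theorem exists_norm_one_pair [Nontrivial X] (hdim : Module.rank ℝ X ≠ 1) :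
    ∃ x y : X, ‖x‖ = 1 ∧ ‖y‖ = 1 ∧ 1 ≤ ‖x - y‖ ∧ 1 ≤ ‖x + y‖ := by
  obtain ⟨x, hx⟩ := exists_norm_eq X zero_le_one
  obtain ⟨g, hg, hgx⟩ := exists_norm_one_apply_eq x
  rw [hx] at hgx
  obtain ⟨y, hy0, hgy⟩ : ∃ y : X, y ≠ 0 ∧ g y = 0 := by
    by_contra! hcon
    refine hdim (rank_eq_one_iff.2 ⟨x, by rintro rfl; simp at hx, fun v => ⟨g v, ?_⟩⟩)
    by_contra hne
    exact hcon (g v • x - v) (sub_ne_zero.2 hne) (by simp [hgx])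
  have hy := norm_inv_norm_smul (norm_pos_iff.2 hy0)
  refine ⟨x, _, hx, hy, ?_, ?_⟩
  · simpa [hgx, hgy] using apply_le_of_norm_le hg.le (le_refl ‖x - ‖y‖⁻¹ • y‖)
  · simpa [hgx, hgy] using apply_le_of_norm_le hg.le (le_refl ‖x + ‖y‖⁻¹ • y‖)

/-- If `|f y| > 1 / 2`, then `x - y` or `x + y` serves, since `f x` is near 1 and normalising only
shrinks the value. The choice depends on `f`, so all three candidates go into the list. -/
theorem IsLush.exists_near_half [Nontrivial X] (hX : IsLush X) (hdim : Module.rank ℝ X ≠ 1)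
    {ε : ℝ} (hε : 0 < ε) (hε1 : ε ≤ 1 / 2) :
    ∃ (f : StrongDual ℝ X) (w : X), ‖f‖ = 1 ∧ ‖w‖ = 1 ∧ |f w| ≤ 1 / 2 ∧
      IsNearSliceHull f ε w := by
  obtain ⟨x, y, hx, hy, hm, hp⟩ := exists_norm_one_pair hdim
  have nm := norm_inv_norm_smul (zero_lt_one.trans_le hm)
  have np := norm_inv_norm_smul (zero_lt_one.trans_le hp)
  obtain ⟨f, hf, hfx, hL⟩ := hX.exists_forall_isNearSliceHull
    [y, ‖x - y‖⁻¹ • (x - y), ‖x + y‖⁻¹ • (x + y)] (by simp [-smul_add, hy, nm, np]) x hx ε hε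
  have hfx1 := apply_le_of_norm_le hf.le hx.le
  have hfy1 := abs_le.2 ⟨neg_le_apply_of_norm_le hf.le hy.le, apply_le_of_norm_le hf.le hy.le⟩
  rw [abs_le] at hfy1
  have key : ∀ v : X, 1 ≤ ‖v‖ → |f v| ≤ 1 / 2 → |f (‖v‖⁻¹ • v)| ≤ 1 / 2 := fun v h1 h2 => by
    rw [map_smul, smul_eq_mul, abs_mul, abs_of_nonneg (by positivity)]
    have := mul_le_mul_of_nonneg_right (inv_le_one_of_one_le₀ h1) (abs_nonneg (f v))
    linarith
  by_cases h : |f y| ≤ 1 / 2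
  · exact ⟨f, y, hf, hy, h, hL y (by simp)⟩
  rcases lt_abs.1 (not_le.1 h) with h | h
  · refine ⟨f, _, hf, nm, key _ hm ?_, hL _ (by simp)⟩
    rw [map_sub, abs_le]
    constructor <;> linarith
  · refine ⟨f, _, hf, np, key _ hp ?_, hL _ (by simp)⟩
    rw [map_add, abs_le]
    constructor <;> linarith

theorem coeff_bounds_of_abs_apply_le_half {f : StrongDual ℝ X} (hf : ‖f‖ ≤ 1) {w a b : X}
    {l ε : ℝ} (hε1 : ε ≤ 1 / 20) (ha : a ∈ unitBallSlice f ε) (hb : b ∈ unitBallSlice f ε)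
    (hl0 : 0 ≤ l) (hl1 : l ≤ 1) (h : ‖w - (l • a - (1 - l) • b)‖ < ε) (hw : |f w| ≤ 1 / 2) :
    1 / 5 ≤ l ∧ l ≤ 4 / 5 := by
  rw [mem_unitBallSlice] at ha hb
  have h1 := abs_lt.1 (abs_apply_sub_lt hf h)
  simp only [map_sub, map_smul, smul_eq_mul] at h1
  have h2 := apply_le_of_norm_le hf ha.1
  have h3 := apply_le_of_norm_le hf hb.1
  rw [abs_le] at hw
  constructor <;> nlinarith

/-- A complete lush space of dimension different from one contains a nontrivial segment in its
unit sphere. -/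
theorem IsLush.exists_ne_norm_add_eq_two [CompleteSpace X] [Nontrivial X] (hX : IsLush X)
    (hdim : Module.rank ℝ X ≠ 1) :
    ∃ a b : X, a ≠ b ∧ ‖a‖ ≤ 1 ∧ ‖b‖ ≤ 1 ∧ 2 ≤ ‖a + b‖ := by
  obtain ⟨f, w, hf, hw, hfw, a, b, l, ha, hb, hl0, hl1, hl⟩ :=
    hX.exists_near_half hdim (ε := 1 / 800) (by norm_num) (by norm_num)
  have hlb := coeff_bounds_of_abs_apply_le_half hf.le (by norm_num) ha hb hl0 hl1 hl hfw
  rw [mem_unitBallSlice] at ha hb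
  have hab : 1 / 4 ≤ ‖a - b‖ := by
    have e : w = (w - (l • a - (1 - l) • b)) + (2 * l - 1) • a + (1 - l) • (a - b) := by module
    have h1 : ‖(2 * l - 1) • a‖ ≤ 3 / 5 := by
      rw [norm_smul, Real.norm_eq_abs]
      have : |2 * l - 1| ≤ 3 / 5 := abs_le.2 ⟨by linarith, by linarith⟩
      nlinarith [norm_nonneg a, abs_nonneg (2 * l - 1)]
    have h2 : ‖(1 - l) • (a - b)‖ ≤ ‖a - b‖ := by
      rw [norm_smul, Real.norm_of_nonneg (by linarith)]
      nlinarith [norm_nonneg (a - b)]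
    have h3 := norm_add₃_le (a := w - (l • a - (1 - l) • b)) (b := (2 * l - 1) • a)
      (c := (1 - l) • (a - b))
    rw [← e, hw] at h3
    linarith
  -- Each coordinate moves by at most `12 / 400` in total, too little to close the gap of `1 / 4`.
  let P : ℕ → X × X → Prop := fun n p =>
    ‖p.1‖ ≤ 1 ∧ ‖p.2‖ ≤ 1 ∧ 2 - 1 / 400 * (1 / 2) ^ n < ‖p.1 + p.2‖
  have h0 : P 0 (a, b) := by
    refine ⟨ha.1, hb.1, ?_⟩
    have := apply_le_of_norm_le hf.le (le_refl ‖a + b‖)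
    rw [map_add] at this
    norm_num
    linarith [ha.2, hb.2]
  obtain ⟨u, p, hu, hp, hd⟩ := exists_seq_tendsto_of_geometric_steps P (6 / 400) (a, b) h0 (by
    rintro n ⟨c, d⟩ ⟨hc, hd, hcd⟩
    have hr : (1 / 2 : ℝ) ^ n ≤ 1 := pow_le_one₀ (by norm_num) (by norm_num)
    have hr0 : (0 : ℝ) < (1 / 2 : ℝ) ^ n := by positivity
    obtain ⟨c', d', hc', hd', hcd', h1, h2⟩ := hX.exists_pair_near hc hd (by positivity)
      (by linarith) hcd (δ := 1 / 400 * (1 / 2) ^ (n + 1)) (by positivity)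
    refine ⟨(c', d'), ⟨hc', hd', hcd'⟩, ?_⟩
    rw [Prod.dist_eq, dist_eq_norm, dist_eq_norm]
    exact max_le (by linarith) (by linarith))
  have hp1 : Tendsto (fun n => (u n).1) atTop (𝓝 p.1) := (continuous_fst.tendsto p).comp hp
  have hp2 : Tendsto (fun n => (u n).2) atTop (𝓝 p.2) := (continuous_snd.tendsto p).comp hp
  refine ⟨p.1, p.2, ?_, le_of_tendsto' hp1.norm fun n => (hu n).1,
    le_of_tendsto' hp2.norm fun n => (hu n).2.1, ?_⟩
  · intro he
    rw [Prod.dist_eq] at hd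
    have d1 := (le_max_left _ _).trans hd
    have d2 := (le_max_right _ _).trans hd
    have := dist_triangle_right a b p.1
    rw [dist_eq_norm a b] at this
    simp only at d1 d2
    rw [← he] at d2
    linarith
  · have hlim : Tendsto (fun n : ℕ => (2 : ℝ) - 1 / 400 * (1 / 2) ^ n) atTop (𝓝 2) := by
      have := (tendsto_pow_atTop_nhds_zero_of_lt_one (r := (1 / 2 : ℝ)) (by norm_num)
        (by norm_num)).const_mul (1 / 400)
      simpa using this.const_sub 2
    exact le_of_tendsto_of_tendsto' hlim (hp1.add hp2).norm fun n => (hu n).2.2.le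

theorem IsLush.not_isStrictlyConvexNorm [CompleteSpace X] [Nontrivial X] (hX : IsLush X)
    (hdim : Module.rank ℝ X ≠ 1) : ¬ IsStrictlyConvexNorm X := by
  intro hsc
  obtain ⟨a, b, hab, ha, hb, hs⟩ := hX.exists_ne_norm_add_eq_two hdim
  have hn : ‖(1 / 2 : ℝ) • a + (1 / 2 : ℝ) • b‖ = 1 := by
    have h2 := norm_add_le a b
    rw [← smul_add, norm_smul, Real.norm_of_nonneg (by norm_num)]
    linarith
  have hm : (1 / 2 : ℝ) • a + (1 / 2 : ℝ) • b ∈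
      Set.extremePoints ℝ (Metric.closedBall (0 : X) 1) := by
    rw [hsc]
    simpa using hn
  have h := mem_extremePoints.1 hm
  have h' := h.2 a (by simpa using ha) b (by simpa using hb)
    ⟨1 / 2, 1 / 2, by norm_num, by norm_num, by norm_num, rfl⟩
  exact hab (h'.1.trans h'.2.symm)

/-! ### Points with two support functionals -/

/-- `f` and `h` almost norm `x` up to `ε`, and they are separated by `y`. -/
structure AlmostNormingPair (y x : X) (ε α β : ℝ) (f h : StrongDual ℝ X) : Prop where
  norm_left : ‖f‖ ≤ 1
  norm_right : ‖h‖ ≤ 1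
  apply_left : 1 - ε ≤ f x
  apply_right : 1 - ε ≤ h x
  left_le : f y ≤ α
  le_right : β ≤ h y

/-- Take `F` almost norming `x - t • y` and `g` norming `x + t • y`: moving `x` along `y` controls
`F y` from above and `g y` from below, up to errors of order `ε / t`. The new point lies in the
slice of `F`, near the normalised `x + t • y`. -/
theorem IsLush.exists_almostNormingPair_near [Nontrivial X] (hX : IsLush X) {x y : X}
    {ε α β t δ : ℝ} {f h : StrongDual ℝ X} (hx : ‖x‖ ≤ 1) (hy : ‖y‖ ≤ 1) (hα : α ≤ 1)
    (hβ : 0 ≤ β) (hε : 0 < ε) (hεt : ε ≤ t) (ht : t ≤ 1 / 16) (hδ : 0 < δ)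
    (H : AlmostNormingPair y x ε α β f h) :
    ∃ (x' : X) (f' h' : StrongDual ℝ X), ‖x'‖ ≤ 1 ∧
      AlmostNormingPair y x' δ (α + 2 * ε / t) (β - 2 * ε / t) f' h' ∧ ‖x - x'‖ ≤ 16 * t := by
  have ht0 : 0 < t := hε.trans_le hεt
  obtain ⟨η, hη, hηε, hηδ⟩ : ∃ η : ℝ, 0 < η ∧ η ≤ ε / 2 ∧ η ≤ δ / 2 :=
    ⟨min (ε / 2) (δ / 2), by positivity, min_le_left _ _, min_le_right _ _⟩
  have hty : ‖t • y‖ ≤ t := by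
    rw [norm_smul, Real.norm_of_nonneg ht0.le]
    nlinarith
  have hp := apply_le_of_norm_le H.norm_left (le_refl ‖x - t • y‖)
  have hq := apply_le_of_norm_le H.norm_right (le_refl ‖x + t • y‖)
  rw [map_sub, map_smul, smul_eq_mul] at hp
  rw [map_add, map_smul, smul_eq_mul] at hq
  have hp1 : 1 - ε - t * α ≤ ‖x - t • y‖ := by
    linarith [mul_le_mul_of_nonneg_left H.left_le ht0.le, H.apply_left]
  have hq1 : 1 - ε + t * β ≤ ‖x + t • y‖ := by
    linarith [mul_le_mul_of_nonneg_left H.le_right ht0.le, H.apply_right]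
  have hp2 : ‖x - t • y‖ ≤ 1 + t := (norm_sub_le _ _).trans (by linarith)
  have hq2 : ‖x + t • y‖ ≤ 1 + t := (norm_add_le _ _).trans (by linarith)
  have htα : t * α ≤ t := by nlinarith
  have htβ : 0 ≤ t * β := by positivity
  have hp0 : 0 < ‖x - t • y‖ := by linarith
  have hq0 : 0 < ‖x + t • y‖ := by linarith
  have nq := norm_inv_norm_smul hq0
  obtain ⟨F, hF, hFp, hL⟩ := hX.exists_forall_isNearSliceHull [‖x + t • y‖⁻¹ • (x + t • y)]
    (by simp [-smul_add, nq]) _ (norm_inv_norm_smul hp0) η hη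
  obtain ⟨a, b, l, ha, hb, hl0, hl1, hl⟩ := hL _ (List.mem_singleton_self _)
  rw [mem_unitBallSlice] at ha hb
  obtain ⟨g, hg, hgq⟩ := exists_norm_one_apply_eq (x + t • y)
  have hFp' := lt_apply_of_lt_apply_normalize hp0 hFp
  rw [map_sub, map_smul, smul_eq_mul] at hFp'
  have hFx := apply_le_of_norm_le hF.le hx
  have hgx := apply_le_of_norm_le hg.le hx
  have hηp : η * ‖x - t • y‖ ≤ ε := by nlinarith
  have hFy : F y ≤ α + 2 * ε / t := by
    have : F y - α ≤ 2 * ε / t := by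
      rw [le_div_iff₀ ht0]
      nlinarith
    linarith
  have hgq' := hgq
  rw [map_add, map_smul, smul_eq_mul] at hgq'
  have hgy : β - 2 * ε / t ≤ g y := by
    have : β - g y ≤ 2 * ε / t := by
      rw [le_div_iff₀ ht0]
      nlinarith
    linarith
  have hFy1 := neg_le_apply_of_norm_le hF.le hy
  have hFq : 1 - 6 * t ≤ F (‖x + t • y‖⁻¹ • (x + t • y)) := by
    rw [map_smul, smul_eq_mul, inv_mul_eq_div, le_div_iff₀ hq0, map_add, map_smul, smul_eq_mul]
    have h1 : (1 - 6 * t) * ‖x + t • y‖ ≤ (1 - 6 * t) * (1 + t) :=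
      mul_le_mul_of_nonneg_left hq2 (by linarith)
    have h2 := mul_le_mul_of_nonneg_left hFy1 ht0.le
    have h3 : (1 - 6 * t) * (1 + t) ≤ 1 - 5 * t := by linarith [mul_self_nonneg t]
    linarith
  have c1 := one_sub_coeff_le hF.le ha.1 hb.2 hl0 hl1 hη hl
  have d1 := norm_sub_le_of_norm_sub_comb_lt ha.1 hb.1 hl1 hl
  -- As `g` attains 1 at the approximated vector and `l ≥ 1 / 2`, the defect of `g a` is at most `2
  -- * η`.
  have hga : 1 - δ ≤ g a := by
    have h1 := abs_lt.1 (abs_apply_sub_lt hg.le hl)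
    rw [map_smul, hgq, smul_eq_mul, inv_mul_cancel₀ hq0.ne'] at h1
    simp only [map_sub, map_smul, smul_eq_mul] at h1
    have h2 := neg_le_apply_of_norm_le hg.le hb.1
    have h3 := apply_le_of_norm_le hg.le ha.1
    have h4 := mul_le_mul_of_nonneg_left h2 (by linarith : 0 ≤ 1 - l)
    have h5 := mul_le_mul_of_nonneg_right (by linarith : 1 / 2 ≤ l) (by linarith : 0 ≤ 1 - g a)
    linarith
  refine ⟨a, F, g, ha.1, ⟨hF.le, hg.le, by linarith [ha.2], hga, hFy, hgy⟩, ?_⟩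
  have d2 : ‖x + t • y - ‖x + t • y‖⁻¹ • (x + t • y)‖ ≤ 2 * t := by
    have e : x + t • y - ‖x + t • y‖⁻¹ • (x + t • y) =
        (‖x + t • y‖ - 1) • ‖x + t • y‖⁻¹ • (x + t • y) := by
      rw [sub_smul, one_smul, smul_inv_smul₀ hq0.ne']
    rw [e, norm_smul, nq, mul_one, Real.norm_eq_abs, abs_le]
    constructor <;> linarith
  have e : x - a = (x + t • y - ‖x + t • y‖⁻¹ • (x + t • y)) +
      (‖x + t • y‖⁻¹ • (x + t • y) - a) - t • y := by abel
  rw [e]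
  refine (norm_sub_le _ _).trans ?_
  have := norm_add_le (x + t • y - ‖x + t • y‖⁻¹ • (x + t • y))
    (‖x + t • y‖⁻¹ • (x + t • y) - a)
  linarith

/-- By weak-star compactness, almost norming functionals with `f y ≤ α` yield a norming one. -/
theorem exists_support_apply_le {x y : X} (hx : ‖x‖ ≤ 1) {α : ℝ}
    (H : ∀ ε : ℝ, 0 < ε → ∃ f : StrongDual ℝ X, ‖f‖ ≤ 1 ∧ 1 - ε ≤ f x ∧ f y ≤ α) :
    ∃ f : StrongDual ℝ X, ‖f‖ = 1 ∧ f x = 1 ∧ f y ≤ α := by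
  let K : Set (WeakDual ℝ X) :=
    (WeakDual.toStrongDual ⁻¹' Metric.closedBall (0 : StrongDual ℝ X) 1) ∩ {f | f y ≤ α}
  have hK : IsCompact K := (WeakDual.isCompact_closedBall (𝕜 := ℝ) (E := X) 0 1).inter_right
    (isClosed_le (WeakDual.eval_continuous y) continuous_const)
  have mem : ∀ f : StrongDual ℝ X, ‖f‖ ≤ 1 → f y ≤ α → StrongDual.toWeakDual f ∈ K :=
    fun f h1 h2 => ⟨by simpa using h1, h2⟩
  obtain ⟨f₁, h1, -, h2⟩ := H 1 one_pos
  -- The maximum over `K` of evaluation at `x` is at least `1 - ε` for every `ε`.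
  obtain ⟨g, hg, hmax⟩ := hK.exists_isMaxOn ⟨_, mem f₁ h1 h2⟩
    (WeakDual.eval_continuous x).continuousOn
  have hg1 : ‖WeakDual.toStrongDual g‖ ≤ 1 := by simpa using hg.1
  have hgx : 1 ≤ WeakDual.toStrongDual g x := le_of_forall_pos_sub_le fun ε hε => by
    obtain ⟨f, hf, hfx, hfy⟩ := H ε hε
    exact hfx.trans (hmax (mem f hf hfy))
  refine ⟨WeakDual.toStrongDual g, le_antisymm hg1 ?_, le_antisymm ?_ hgx, hg.2⟩
  · have h3 := (WeakDual.toStrongDual g).le_opNorm x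
    have h4 := le_abs_self (WeakDual.toStrongDual g x)
    rw [Real.norm_eq_abs] at h3
    nlinarith [norm_nonneg (WeakDual.toStrongDual g)]
  · exact apply_le_of_norm_le hg1 hx

/-- A complete lush space of dimension different from one has a point of its unit ball with
almost norming functionals of arbitrary precision that stay apart on a fixed vector. -/
theorem IsLush.exists_forall_almostNormingPair [CompleteSpace X] [Nontrivial X] (hX : IsLush X)
    (hdim : Module.rank ℝ X ≠ 1) :
    ∃ x y : X, ‖x‖ ≤ 1 ∧ ∀ ε : ℝ, 0 < ε → ∃ f h : StrongDual ℝ X,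
      AlmostNormingPair y x ε (9 / 16) (15 / 16) f h := by
  obtain ⟨f, w, hf, hw, hfw, a, b, l, ha, hb, hl0, hl1, hl⟩ :=
    hX.exists_near_half hdim (ε := 1 / 40960) (by norm_num) (by norm_num)
  have hlb := coeff_bounds_of_abs_apply_le_half hf.le (by norm_num) ha hb hl0 hl1 hl hfw
  rw [mem_unitBallSlice] at ha hb
  obtain ⟨h, hh, hhw⟩ := exists_norm_one_apply_eq w
  have hha : 1 - 1 / 4096 ≤ h a := by
    have h1 := abs_lt.1 (abs_apply_sub_lt hh.le hl)
    simp only [map_sub, map_smul, smul_eq_mul, hhw, hw] at h1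
    have h2 := neg_le_apply_of_norm_le hh.le hb.1
    have h3 := apply_le_of_norm_le hh.le ha.1
    nlinarith
  -- With `r = (1 / 2) ^ n` and `t = r / 64`, the error `r ^ 2 / 4096` costs `r / 32` in separation,
  -- exactly half the slack `r / 16`, and the point moves by at most `r / 4`.
  let P : ℕ → X → Prop := fun n x => ‖x‖ ≤ 1 ∧ ∃ f h : StrongDual ℝ X,
    AlmostNormingPair w x (((1 / 2) ^ n) ^ 2 / 4096) (9 / 16 - (1 / 2) ^ n / 16)
      (15 / 16 + (1 / 2) ^ n / 16) f h
  have h0 : P 0 a := ⟨ha.1, f, h, hf.le, hh.le, by norm_num; linarith [ha.2],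
    by norm_num at hha ⊢; linarith, by norm_num; linarith [(abs_le.1 hfw).2],
    by norm_num [hhw, hw]⟩
  obtain ⟨u, x, hu, hx, -⟩ := exists_seq_tendsto_of_geometric_steps P (1 / 4) a h0 (by
    rintro n z ⟨hz, f, h, H⟩
    have hr1 : (1 / 2 : ℝ) ^ n ≤ 1 := pow_le_one₀ (by norm_num) (by norm_num)
    have hr0 : (0 : ℝ) < (1 / 2 : ℝ) ^ n := by positivity
    simp only [P, pow_succ (1 / 2 : ℝ) n]
    generalize (1 / 2 : ℝ) ^ n = r at *
    obtain ⟨x', f', h', hx', H', hd⟩ := hX.exists_almostNormingPair_near (t := r / 64)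
      (δ := (r * (1 / 2)) ^ 2 / 4096) hz hw.le (by linarith) (by linarith) (by positivity)
      (by nlinarith) (by linarith) (by positivity) H
    have e : 2 * (r ^ 2 / 4096) / (r / 64) = r / 32 := by
      field_simp
      norm_num
    rw [e] at H'
    refine ⟨x', ⟨hx', f', h', H'.norm_left, H'.norm_right, H'.apply_left, H'.apply_right,
      by linarith [H'.left_le], by linarith [H'.le_right]⟩, ?_⟩
    rw [dist_eq_norm]
    linarith)
  refine ⟨x, w, le_of_tendsto' hx.norm fun n => (hu n).1, fun ε hε => ?_⟩
  have hpow : Tendsto (fun n : ℕ => (1 / 2 : ℝ) ^ n) atTop (𝓝 0) :=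
    tendsto_pow_atTop_nhds_zero_of_lt_one (by norm_num) (by norm_num)
  obtain ⟨n, hn, hxn⟩ := ((hpow.eventually_lt_const (half_pos hε)).and
    (hx.eventually (Metric.ball_mem_nhds x (half_pos hε)))).exists
  obtain ⟨-, f, h, H⟩ := hu n
  have hr1 : (1 / 2 : ℝ) ^ n ≤ 1 := pow_le_one₀ (by norm_num) (by norm_num)
  have hr0 : (0 : ℝ) < (1 / 2 : ℝ) ^ n := by positivity
  have hsq : ((1 / 2 : ℝ) ^ n) ^ 2 / 4096 ≤ ε / 2 := by nlinarith
  rw [dist_eq_norm] at hxn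
  have k1 := (abs_lt.1 (abs_apply_sub_lt H.norm_left hxn)).2
  have k2 := (abs_lt.1 (abs_apply_sub_lt H.norm_right hxn)).2
  exact ⟨f, h, H.norm_left, H.norm_right, by linarith [H.apply_left],
    by linarith [H.apply_right], by linarith [H.left_le], by linarith [H.le_right]⟩

theorem IsLush.not_isSmoothNorm [CompleteSpace X] [Nontrivial X] (hX : IsLush X)
    (hdim : Module.rank ℝ X ≠ 1) : ¬ IsSmoothNorm X := by
  intro hsm
  obtain ⟨x, y, hx, H⟩ := hX.exists_forall_almostNormingPair hdim
  obtain ⟨f, hf, hfx, hfy⟩ := exists_support_apply_le (y := y) (α := 9 / 16) hx fun ε hε => by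
    obtain ⟨f, h, H⟩ := H ε hε
    exact ⟨f, H.norm_left, H.apply_left, H.left_le⟩
  obtain ⟨g, hg, hgx, hgy⟩ := exists_support_apply_le (y := -y) (α := -(15 / 16)) hx
    fun ε hε => by
      obtain ⟨f, h, H⟩ := H ε hε
      exact ⟨h, H.norm_right, H.apply_right, by rw [map_neg]; linarith [H.le_right]⟩
  have hx1 : ‖x‖ = 1 := le_antisymm hx (hfx ▸ apply_le_of_norm_le hf.le le_rfl)
  have := (hsm x hx1).unique ⟨hf, hfx⟩ ⟨hg, hgx⟩
  rw [map_neg, ← this] at hgy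
  linarith

end Lush

theorem corollary4p6 (X : Type*) [NormedAddCommGroup X] [NormedSpace ℝ X] [CompleteSpace X]
    [Nontrivial X] (hX : IsLush X) (hdim : Module.rank ℝ X ≠ 1) :
    ¬ IsStrictlyConvexNorm X ∧ ¬ IsSmoothNorm X :=
  ⟨hX.not_isStrictlyConvexNorm hdim, hX.not_isSmoothNorm hdim⟩
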